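/- Let $l\in\mathbb{N}-\frac12=\{\frac12,\frac32,\frac52,\dots\}$. Let $\mathbb{C}h+\tilde{\mathcal H}^{(l)}$ be the complex Lie algebra with basis $h,z,p_0,\dots,p_{2l}$, in which $z$ is central and $$[h,p_k]=2(l-k)p_k,\qquad [p_k,p_{k'}]=\delta_{k+k',2l}(-1)^{k+l+\frac12}\,k!\,(2l-k)!\,z ,$$ and let $\tilde{\mathcal H}^{(l)}$ be the subalgebra spanned by $z,p_0,\dots,p_{2l}$. For a module $V$ put $V_\mu=\{v\in V: hv=\mu v\}$ and $\mathrm{supp}(V)=\{\mu\in\mathbb{C}: V_\mu\neq 0\}$; $V$ is a weight module if $V=\bigoplus_{\mu\in\mathbb{C}}V_\mu$. It is a highest (respectively lowest) weight module if it is generated by a nonzero common eigenvector of $h$ and $z$ that is annihilated by all $p_k$ with $k<l$ (respectively $k>l$). For $\dot z\in\mathbb{C}\setminus\{0\}$, $a\in\mathbb{C}\setminus\mathbb{Z}$, let $D(a,\dot z)$ be the $\tilde{\mathcal H}^{(1/2)}$-module $\mathbb{C}[x,x^{-1}]$ with $$p_1x^i=x^{i+1},\qquad p_0x^i=-\dot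 z(a+i)x^{i-1},\qquad zx^i=\dot z x^i\qquad(i\in\mathbb{Z});$$ for every $b\in\mathbb{C}$ it becomes a $\mathbb{C}h+\tilde{\mathcal H}^{(1/2)}$-module by $hx^i=(b-i)x^i$. Let $V$ be a simple weight $\mathbb{C}h+\tilde{\mathcal H}^{(l)}$-module on which $z$ acts as a nonzero scalar $\dot z$, and suppose that for some $\lambda\in\mathbb{C}$ one has $\mathrm{supp}(V)\subset\lambda+\mathbb{Z}$ and $\dim V_\lambda<\infty$. (i) If $l=\frac12$, then $V$ is a highest weight module, or a lowest weight module, or isomorphic to $D(a,\dot z)$ with $hx^i=(b-i)x^i$, for some $a\in\mathbb{C}\setminus\mathbb{Z}$ and $b\in\mathbb{C}$. (ii) If $l>\frac12$, then $V$ is a highest weight module or a lowest weight module. -/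

import Mathlib

open scoped LaurentPolynomial

universe u

noncomputable section

/-- The underlying space of the Lie algebra `ℂh + H̃⁽ˡ⁾` for `l = m + 1/2` (so `2l = 2m + 1`), in
coordinates: the triple `(a, u, s)` is `a h + ∑ₖ uₖ pₖ + s z`, with `k = 0, …, 2l`. -/
def ExtHeis (m : ℕ) : Type := ℂ × (Fin (2 * m + 2) → ℂ) × ℂ

namespace ExtHeis

variable {m : ℕ}

instance : AddCommGroup (ExtHeis m) :=
  inferInstanceAs (AddCommGroup (ℂ × (Fin (2 * m + 2) → ℂ) × ℂ))

instance : Module ℂ (ExtHeis m) :=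
  inferInstanceAs (Module ℂ (ℂ × (Fin (2 * m + 2) → ℂ) × ℂ))

/-- The eigenvalue `2 (l - k) = 2m + 1 - 2k` of `ad h` on `pₖ`. -/
def wt (k : Fin (2 * m + 2)) : ℤ := 2 * m + 1 - 2 * (k : ℕ)

/-- The structure constant `(-1)^(k + l + 1/2) k! (2l - k)!`, for which `[pₖ, p_{2l-k}]` is this
multiple of `z`. -/
def cocycle (k : Fin (2 * m + 2)) : ℂ :=
  (-1) ^ ((k : ℕ) + m + 1) * (k : ℕ).factorial * (2 * m + 1 - (k : ℕ)).factorial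

/-- The element `h`. -/
def h : ExtHeis m := ((1, 0, 0) : ℂ × (Fin (2 * m + 2) → ℂ) × ℂ)

/-- The element `pₖ`. -/
def p (k : Fin (2 * m + 2)) : ExtHeis m :=
  ((0, Pi.single k 1, 0) : ℂ × (Fin (2 * m + 2) → ℂ) × ℂ)

/-- The central element `z`. -/
def z : ExtHeis m := ((0, 0, 1) : ℂ × (Fin (2 * m + 2) → ℂ) × ℂ)

/-- The bracket: `z` is central, `[h, pₖ] = 2 (l - k) pₖ` and
`[pₖ, pⱼ] = δ_{k+j,2l} (-1)^(k+l+1/2) k! (2l-k)! z`. Here `k.rev = 2l - k`. -/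
instance : Bracket (ExtHeis m) (ExtHeis m) where
  bracket x y :=
    ((0, fun k => (wt k : ℂ) * (x.1 * y.2.1 k - y.1 * x.2.1 k),
      ∑ k, cocycle k * (x.2.1 k * y.2.1 k.rev)) : ℂ × (Fin (2 * m + 2) → ℂ) × ℂ)

@[ext] theorem ext {x y : ExtHeis m} (h₁ : x.1 = y.1) (h₂ : ∀ k, x.2.1 k = y.2.1 k)
    (h₃ : x.2.2 = y.2.2) : x = y :=
  Prod.ext h₁ (Prod.ext (funext h₂) h₃)

@[simp] theorem add_fst (x y : ExtHeis m) : (x + y).1 = x.1 + y.1 := rfl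
@[simp] theorem add_mid (x y : ExtHeis m) (k) : (x + y).2.1 k = x.2.1 k + y.2.1 k := rfl
@[simp] theorem add_last (x y : ExtHeis m) : (x + y).2.2 = x.2.2 + y.2.2 := rfl
@[simp] theorem h_fst : (h : ExtHeis m).1 = 1 := rfl
@[simp] theorem h_mid (k) : (h : ExtHeis m).2.1 k = 0 := rfl
@[simp] theorem h_last : (h : ExtHeis m).2.2 = 0 := rfl
@[simp] theorem p_fst (j) : (p j : ExtHeis m).1 = 0 := rfl
@[simp] theorem p_mid (j k) : (p j : ExtHeis m).2.1 k = if k = j then 1 else 0 :=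
  Pi.single_apply j 1 k
@[simp] theorem p_last (j) : (p j : ExtHeis m).2.2 = 0 := rfl
@[simp] theorem z_fst : (z : ExtHeis m).1 = 0 := rfl
@[simp] theorem z_mid (k) : (z : ExtHeis m).2.1 k = 0 := rfl
@[simp] theorem z_last : (z : ExtHeis m).2.2 = 1 := rfl
@[simp] theorem zero_fst : (0 : ExtHeis m).1 = 0 := rfl
@[simp] theorem zero_mid (k) : (0 : ExtHeis m).2.1 k = 0 := rfl
@[simp] theorem zero_last : (0 : ExtHeis m).2.2 = 0 := rfl
@[simp] theorem smul_fst (c : ℂ) (x : ExtHeis m) : (c • x).1 = c * x.1 := rfl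
@[simp] theorem smul_mid (c : ℂ) (x : ExtHeis m) (k) : (c • x).2.1 k = c * x.2.1 k := rfl
@[simp] theorem smul_last (c : ℂ) (x : ExtHeis m) : (c • x).2.2 = c * x.2.2 := rfl
@[simp] theorem lie_fst (x y : ExtHeis m) : ⁅x, y⁆.1 = 0 := rfl
@[simp] theorem lie_mid (x y : ExtHeis m) (k) :
    ⁅x, y⁆.2.1 k = (wt k : ℂ) * (x.1 * y.2.1 k - y.1 * x.2.1 k) := rfl
@[simp] theorem lie_last (x y : ExtHeis m) :
    ⁅x, y⁆.2.2 = ∑ k, cocycle k * (x.2.1 k * y.2.1 k.rev) := rfl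

theorem wt_rev (k : Fin (2 * m + 2)) : wt k.rev = -wt k := by
  have := k.isLt
  simp only [wt, Fin.val_rev]
  omega

theorem cocycle_rev (k : Fin (2 * m + 2)) : cocycle k.rev = -cocycle k := by
  have hk := k.isLt
  have h1 : 2 * m + 2 - ((k : ℕ) + 1) = 2 * m + 1 - k := by omega
  have h2 : 2 * m + 1 - (2 * m + 1 - (k : ℕ)) = k := by omega
  have h3 : ((-1 : ℂ)) ^ (2 * m + 1 - (k : ℕ) + m + 1) = -(-1) ^ ((k : ℕ) + m + 1) := by
    rcases Nat.even_or_odd ((k : ℕ) + m + 1) with he | ho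
    · have : Odd (2 * m + 1 - (k : ℕ) + m + 1) := by
        rw [Nat.odd_iff]; rw [Nat.even_iff] at he; omega
      rw [he.neg_one_pow, this.neg_one_pow]
    · have : Even (2 * m + 1 - (k : ℕ) + m + 1) := by
        rw [Nat.even_iff]; rw [Nat.odd_iff] at ho; omega
      rw [ho.neg_one_pow, this.neg_one_pow, neg_neg]
  simp only [cocycle, Fin.val_rev, h1, h2, h3]
  ring

instance : LieRing (ExtHeis m) where
  add_lie x y w := by
    ext
    · simp
    · simp; ring
    · simp only [lie_last, add_last, add_mid, ← Finset.sum_add_distrib]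
      exact Finset.sum_congr rfl fun k _ => by ring
  lie_add x y w := by
    ext
    · simp
    · simp; ring
    · simp only [lie_last, add_last, add_mid, ← Finset.sum_add_distrib]
      exact Finset.sum_congr rfl fun k _ => by ring
  lie_self x := by
    ext
    · simp
    · simp
    · simp only [lie_last, zero_last]
      have key : ∑ k, cocycle k * (x.2.1 k * x.2.1 k.rev)
          = -∑ k, cocycle k * (x.2.1 k * x.2.1 k.rev) := by
        conv_lhs => rw [← Equiv.sum_comp Fin.revPerm]
        rw [← Finset.sum_neg_distrib]
        refine Finset.sum_congr rfl fun k _ => ?_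
        simp only [Fin.revPerm_apply, cocycle_rev, Fin.rev_rev]
        ring
      exact self_eq_neg.mp key
  leibniz_lie x y w := by
    ext
    · simp
    · simp; ring
    · simp only [lie_last, add_last, lie_mid, ← Finset.sum_add_distrib, wt_rev]
      have key : ∑ k, cocycle k * (wt k : ℂ) * (x.2.1 k * y.2.1 k.rev)
          = ∑ k, cocycle k * (wt k : ℂ) * (y.2.1 k * x.2.1 k.rev) := by
        rw [← Equiv.sum_comp Fin.revPerm]
        refine Finset.sum_congr rfl fun k _ => ?_
        simp only [Fin.revPerm_apply, cocycle_rev, wt_rev, Fin.rev_rev]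
        push_cast
        ring
      rw [← sub_eq_zero, ← Finset.sum_sub_distrib]
      rw [← sub_eq_zero, ← Finset.sum_sub_distrib] at key
      rw [← mul_zero w.1, ← key, Finset.mul_sum]
      refine Finset.sum_congr rfl fun k _ => ?_
      push_cast
      ring

instance : LieAlgebra ℂ (ExtHeis m) where
  lie_smul c x y := by
    ext
    · simp
    · simp; ring
    · simp only [lie_last, smul_last, smul_mid, Finset.mul_sum]
      exact Finset.sum_congr rfl fun k _ => by ring

/-! The defining relations, for the basis vectors. -/

theorem lie_h_p (k : Fin (2 * m + 2)) : ⁅(h : ExtHeis m), p k⁆ = (wt k : ℂ) • p k := by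
  ext i
  · simp
  · by_cases hi : i = k
    · subst hi; simp
    · simp [hi]
  · simp

theorem lie_z (x : ExtHeis m) : ⁅(z : ExtHeis m), x⁆ = 0 := by
  ext <;> simp

theorem lie_p_p (k j : Fin (2 * m + 2)) :
    ⁅(p k : ExtHeis m), p j⁆ = if (k : ℕ) + j = 2 * m + 1 then cocycle k • z else 0 := by
  have hkj : (k : ℕ) + j = 2 * m + 1 ↔ k.rev = j := by
    rw [Fin.ext_iff, Fin.val_rev]; omega
  have hsum : ∑ i, cocycle i * ((if i = k then 1 else 0) * (if i.rev = j then 1 else 0))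
      = if k.rev = j then cocycle k else 0 := by
    rw [Finset.sum_eq_single k]
    · simp
    · intro i _ hi; simp [hi]
    · simp
  simp only [hkj]
  ext
  · split_ifs <;> simp
  · split_ifs <;> simp
  · simp only [lie_last, p_mid, hsum]
    split_ifs <;> simp

end ExtHeis

/-! ### Modules over `ℂh + H̃⁽ˡ⁾` -/

section Modules

variable (m : ℕ) (V : Type u) [AddCommGroup V] [Module ℂ V] [LieRingModule (ExtHeis m) V]
  [LieModule ℂ (ExtHeis m) V]

/-- The weight space `V_μ = {v | h v = μ v}`. -/
def weightSpace (μ : ℂ) : Submodule ℂ V :=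
  Module.End.eigenspace (LieModule.toEnd ℂ (ExtHeis m) V ExtHeis.h) μ

/-- The support `{μ | V_μ ≠ 0}`. -/
def weightSupport : Set ℂ := {μ | weightSpace m V μ ≠ ⊥}

/-- `V` is a weight module: it is the direct sum of its weight spaces. -/
def IsWeightModule : Prop :=
  letI := Classical.decEq ℂ
  DirectSum.IsInternal (weightSpace m V)

/-- `V` has central charge `c`: the element `z` acts on `V` as the scalar `c`. -/
def HasCentralCharge (c : ℂ) : Prop := ∀ v : V, ⁅(ExtHeis.z : ExtHeis m), v⁆ = c • v

/-- `V` is a highest weight module: it is generated by a nonzero common eigenvector of `h` and `z`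
that is annihilated by every `pₖ` of positive `ad h`-degree, i.e. with `k < l`. -/
def IsHighestWeightModule : Prop :=
  ∃ (v : V) (μ c : ℂ), v ≠ 0 ∧ ⁅(ExtHeis.h : ExtHeis m), v⁆ = μ • v ∧
    ⁅(ExtHeis.z : ExtHeis m), v⁆ = c • v ∧
    (∀ k, 0 < ExtHeis.wt k → ⁅(ExtHeis.p k : ExtHeis m), v⁆ = 0) ∧
    LieSubmodule.lieSpan ℂ (ExtHeis m) {v} = ⊤

/-- `V` is a lowest weight module: it is generated by a nonzero common eigenvector of `h` and `z`
that is annihilated by every `pₖ` of negative `ad h`-degree, i.e. with `k > l`. -/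
def IsLowestWeightModule : Prop :=
  ∃ (v : V) (μ c : ℂ), v ≠ 0 ∧ ⁅(ExtHeis.h : ExtHeis m), v⁆ = μ • v ∧
    ⁅(ExtHeis.z : ExtHeis m), v⁆ = c • v ∧
    (∀ k, ExtHeis.wt k < 0 → ⁅(ExtHeis.p k : ExtHeis m), v⁆ = 0) ∧
    LieSubmodule.lieSpan ℂ (ExtHeis m) {v} = ⊤

end Modules

/-! ### The modules `D(a, c)` for `l = 1/2` -/

/-- The linear operator on `ℂ[x, x⁻¹]` with `xⁱ ↦ f i • x^(i + d)`. -/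
def shiftOp (f : ℤ → ℂ) (d : ℤ) : Module.End ℂ ℂ[T;T⁻¹] :=
  (AddMonoidAlgebra.basis ℤ ℂ).constr ℂ fun i => f i • LaurentPolynomial.T (i + d)

theorem shiftOp_T (f : ℤ → ℂ) (d i : ℤ) :
    shiftOp f d (LaurentPolynomial.T i) = f i • LaurentPolynomial.T (i + d) :=
  (AddMonoidAlgebra.basis ℤ ℂ).constr_basis ℂ _ i

/-- The operator by which `α h + u₀ p₀ + u₁ p₁ + s z` acts on `D(a, c)`, extended by an action
of `h`: on `ℂ[x, x⁻¹]` one has `p₁ xⁱ = x^(i+1)`, `p₀ xⁱ = -c (a + i) x^(i-1)`, `z xⁱ = c xⁱ` and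
`h xⁱ = (b - i) xⁱ`. -/
def densityOp (a c b : ℂ) (y : ExtHeis 0) : Module.End ℂ ℂ[T;T⁻¹] :=
  y.1 • shiftOp (fun i => b - i) 0 + y.2.1 0 • shiftOp (fun i => -c * (a + i)) (-1)
    + y.2.1 1 • shiftOp (fun _ => 1) 1 + y.2.2 • shiftOp (fun _ => c) 0

theorem densityOp_add (a c b : ℂ) (y w : ExtHeis 0) :
    densityOp a c b (y + w) = densityOp a c b y + densityOp a c b w := by
  simp only [densityOp, ExtHeis.add_fst, ExtHeis.add_mid, ExtHeis.add_last, add_smul]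
  abel

theorem densityOp_smul (a c b t : ℂ) (y : ExtHeis 0) :
    densityOp a c b (t • y) = t • densityOp a c b y := by
  simp only [densityOp, ExtHeis.smul_fst, ExtHeis.smul_mid, ExtHeis.smul_last, mul_smul, smul_add]

theorem densityOp_T (a c b : ℂ) (y : ExtHeis 0) (i : ℤ) :
    densityOp a c b y (LaurentPolynomial.T i)
      = (y.1 * (b - i) + y.2.2 * c) • LaurentPolynomial.T i
        + (y.2.1 0 * (-c * (a + i))) • LaurentPolynomial.T (i - 1)
        + y.2.1 1 • LaurentPolynomial.T (i + 1) := by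
  simp only [densityOp, LinearMap.add_apply, LinearMap.smul_apply, shiftOp_T, add_zero,
    ← sub_eq_add_neg]
  module

theorem densityOp_lie (a c b : ℂ) (y w : ExtHeis 0) :
    densityOp a c b ⁅y, w⁆
      = densityOp a c b y * densityOp a c b w - densityOp a c b w * densityOp a c b y := by
  refine (AddMonoidAlgebra.basis ℤ ℂ).ext fun i => ?_
  change densityOp a c b ⁅y, w⁆ (LaurentPolynomial.T i)
    = densityOp a c b y (densityOp a c b w (LaurentPolynomial.T i))
      - densityOp a c b w (densityOp a c b y (LaurentPolynomial.T i))
  have hs : ∑ k : Fin (2 * 0 + 2), ExtHeis.cocycle k * (y.2.1 k * w.2.1 k.rev)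
      = y.2.1 1 * w.2.1 0 - y.2.1 0 * w.2.1 1 := by
    rw [Fin.sum_univ_two]
    simp [ExtHeis.cocycle, Fin.rev]
    ring
  simp only [densityOp_T, map_add, map_smul, ExtHeis.lie_fst, ExtHeis.lie_mid,
    ExtHeis.lie_last, hs, add_sub_cancel_right, sub_add_cancel]
  simp [ExtHeis.wt]
  module

/-- The space `ℂ[x, x⁻¹]` as a module over `ℂh + H̃⁽¹ᐟ²⁾`: its restriction to `H̃⁽¹ᐟ²⁾` is the
module `D(a, c)`, and `h` acts by `h xⁱ = (b - i) xⁱ`. -/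
def DModule (_a _c _b : ℂ) : Type := ℂ[T;T⁻¹]

namespace DModule

variable (a c b : ℂ)

instance : AddCommGroup (DModule a c b) := inferInstanceAs (AddCommGroup ℂ[T;T⁻¹])

instance : Module ℂ (DModule a c b) := inferInstanceAs (Module ℂ ℂ[T;T⁻¹])

/-- The basis vector `xⁱ`. -/
def x (i : ℤ) : DModule a c b := (LaurentPolynomial.T i : ℂ[T;T⁻¹])

instance : Bracket (ExtHeis 0) (DModule a c b) where
  bracket y f := densityOp a c b y f

theorem lie_def (y : ExtHeis 0) (f : DModule a c b) : ⁅y, f⁆ = densityOp a c b y f := rfl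

instance : LieRingModule (ExtHeis 0) (DModule a c b) where
  add_lie y w f := LinearMap.congr_fun (densityOp_add a c b y w) f
  lie_add y f g := (densityOp a c b y).map_add f g
  leibniz_lie y w f := by
    have := LinearMap.congr_fun (densityOp_lie a c b y w) f
    exact (eq_sub_iff_add_eq.1 this).symm

instance : LieModule ℂ (ExtHeis 0) (DModule a c b) where
  smul_lie t y f := LinearMap.congr_fun (densityOp_smul a c b t y) f
  lie_smul t y f := (densityOp a c b y).map_smul t f

theorem lie_h_x (i : ℤ) : ⁅(ExtHeis.h : ExtHeis 0), x a c b i⁆ = (b - i) • x a c b i := by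
  refine (densityOp_T a c b (ExtHeis.h) i).trans ?_
  change _ = (b - i : ℂ) • (LaurentPolynomial.T i : ℂ[T;T⁻¹])
  simp

theorem lie_p_zero_x (i : ℤ) :
    ⁅(ExtHeis.p 0 : ExtHeis 0), x a c b i⁆ = (-c * (a + i)) • x a c b (i - 1) := by
  refine (densityOp_T a c b (ExtHeis.p 0) i).trans ?_
  change _ = (-c * (a + i)) • (LaurentPolynomial.T (i - 1) : ℂ[T;T⁻¹])
  simp

theorem lie_p_one_x (i : ℤ) : ⁅(ExtHeis.p 1 : ExtHeis 0), x a c b i⁆ = x a c b (i + 1) := by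
  refine (densityOp_T a c b (ExtHeis.p 1) i).trans ?_
  change _ = (LaurentPolynomial.T (i + 1) : ℂ[T;T⁻¹])
  simp

theorem lie_z_x (i : ℤ) : ⁅(ExtHeis.z : ExtHeis 0), x a c b i⁆ = c • x a c b i := by
  refine (densityOp_T a c b (ExtHeis.z) i).trans ?_
  change _ = c • (LaurentPolynomial.T i : ℂ[T;T⁻¹])
  simp

end DModule

end

/-! Since `ad pₖ` is nilpotent, the vectors killed by a power of `pₖ` form a submodule, so on a
simple `V` each `pₖ` is injective or locally nilpotent. As `pₖ` and `p_{2l-k}` satisfy a Weyl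
relation with nonzero scalar, at least one of them is injective (`injective_pEnd_or_rev`). If no
`pₖ` of positive degree is injective, these commuting operators have a common kernel vector and `V`
is a highest weight module; symmetrically for lowest weight.

Otherwise some `pₖ` of positive and some `pⱼ` of negative degree are injective, which forces `V_λ ≠
0`. If `j ≠ 2l - k`, a monomial `T` in `pₖ`, `pⱼ` of degree zero acts injectively on `V_λ`, and `t =
pₖ p_{2l-k}` satisfies `[t, T] = κ T` with `κ ≠ 0`; a trace rules this out in finite dimension. For
`l > 1/2` such a pair can always be found. For `l = 1/2` the only pair is `p₀, p₁`, and an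
eigenvector of `p₁ p₀` in `V_λ` yields the module `D(a, c)`. -/

noncomputable section

/-! ### Operators with `[t, T] = κ T` -/

/-- On a nonzero finite-dimensional space, an operator `T` with `[t, T] = κ T`, `κ ≠ 0`, is not
injective. -/
theorem not_injective_of_comm_eq_smul {W : Type*} [AddCommGroup W] [Module ℂ W]
    [FiniteDimensional ℂ W] [Nontrivial W] {t T : Module.End ℂ W} {κ : ℂ} (hκ : κ ≠ 0)
    (h : t * T = T * t + κ • T) : ¬ Function.Injective T := by
  intro hT
  obtain ⟨S, hST⟩ : ∃ S : Module.End ℂ W, S * T = 1 := by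
    refine ⟨(LinearEquiv.ofInjectiveEndo T hT).symm, LinearMap.ext fun w => ?_⟩
    exact (LinearEquiv.ofInjectiveEndo T hT).symm_apply_apply w
  have hTS : T * S = 1 := mul_eq_one_comm.1 hST
  -- The conjugate of `t` by `T` is `t + κ`; equality of traces gives `κ dim W = 0`.
  have h1 : S * (t * T) = t + κ • 1 := by
    rw [h, mul_add, ← mul_assoc, hST, one_mul, mul_smul_comm, hST]
  have h2 : LinearMap.trace ℂ W (S * (t * T)) = LinearMap.trace ℂ W t := by
    rw [LinearMap.trace_mul_comm, mul_assoc, hTS, mul_one]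
  rw [h1, map_add, map_smul, LinearMap.trace_one] at h2
  have h3 : (Module.finrank ℂ W : ℂ) ≠ 0 := by
    exact_mod_cast (Module.finrank_pos (R := ℂ) (M := W)).ne'
  exact mul_ne_zero hκ h3 (by simpa using h2)

/-- If `[A, B] = κ` is a scalar, then `[A, Bⁿ⁺¹] = (n + 1) κ Bⁿ`. -/
theorem mul_pow_succ_of_comm_eq_smul_one {R : Type*} [Ring R] [Algebra ℂ R] {A B : R} {κ : ℂ}
    (h : A * B = B * A + κ • 1) (n : ℕ) :
    A * B ^ (n + 1) = B ^ (n + 1) * A + ((n + 1) * κ) • B ^ n := by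
  induction n with
  | zero => simp [h]
  | succ n ih =>
    rw [pow_succ, ← mul_assoc, ih, add_mul, mul_assoc, h, mul_add, ← mul_assoc, smul_mul_assoc,
      mul_smul_comm, mul_one, ← pow_succ, ← pow_succ, add_assoc, ← add_smul]
    push_cast
    ring_nf

theorem LieSubmodule.lieSpan_singleton_eq_top {R L M : Type*} [CommRing R] [LieRing L]
    [AddCommGroup M] [Module R M] [LieRingModule L M] [LieModule.IsIrreducible R L M] {v : M}
    (hv : v ≠ 0) : LieSubmodule.lieSpan R L {v} = ⊤ := by
  refine (eq_bot_or_eq_top _).resolve_left fun h => hv ?_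
  simpa [h] using LieSubmodule.subset_lieSpan (R := R) (L := L) (Set.mem_singleton v)

/-! ### The operators `pₖ` on a module -/

namespace ExtHeis

variable {m : ℕ} {V : Type u} [AddCommGroup V] [Module ℂ V] [LieRingModule (ExtHeis m) V]
  [LieModule ℂ (ExtHeis m) V]

theorem cocycle_ne_zero (k : Fin (2 * m + 2)) : cocycle k ≠ 0 := by
  simp [cocycle, Nat.factorial_ne_zero]

theorem lie_p_mem_weightSpace {μ : ℂ} {v : V} (hv : v ∈ weightSpace m V μ)
    (k : Fin (2 * m + 2)) : ⁅(p k : ExtHeis m), v⁆ ∈ weightSpace m V (μ + wt k) := by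
  rw [weightSpace, Module.End.mem_eigenspace_iff, LieModule.toEnd_apply_apply] at hv ⊢
  rw [leibniz_lie, hv, lie_h_p, smul_lie, lie_smul, ← add_smul, add_comm]

variable (V) in
/-- The operator by which `pₖ` acts on `V`. -/
def pEnd (k : Fin (2 * m + 2)) : Module.End ℂ V := LieModule.toEnd ℂ (ExtHeis m) V (p k)

theorem pEnd_apply (k : Fin (2 * m + 2)) (v : V) : pEnd V k v = ⁅(p k : ExtHeis m), v⁆ := rfl

theorem pEnd_pow_mem_weightSpace {μ : ℂ} {v : V} (hv : v ∈ weightSpace m V μ)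
    (k : Fin (2 * m + 2)) (n : ℕ) : (pEnd V k ^ n) v ∈ weightSpace m V (μ + n * wt k) := by
  induction n with
  | zero => simpa using hv
  | succ n ih =>
    rw [pow_succ', Module.End.mul_apply]
    have h := lie_p_mem_weightSpace ih k
    rwa [add_assoc, ← add_one_mul, ← Nat.cast_succ] at h

theorem pEnd_mul_comm (k j : Fin (2 * m + 2)) (hkj : (k : ℕ) + j ≠ 2 * m + 1) :
    pEnd V k * pEnd V j = pEnd V j * pEnd V k := by
  refine LinearMap.ext fun v => ?_
  simp only [Module.End.mul_apply, pEnd_apply]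
  rw [leibniz_lie, lie_p_p, if_neg hkj, zero_lie, zero_add]

theorem pEnd_mul_pEnd_rev {c : ℂ} (hc : HasCentralCharge m V c) (k : Fin (2 * m + 2)) :
    pEnd V k * pEnd V k.rev = pEnd V k.rev * pEnd V k + (cocycle k * c) • 1 := by
  refine LinearMap.ext fun v => ?_
  have hk : (k : ℕ) + k.rev = 2 * m + 1 := by rw [Fin.val_rev]; omega
  simp only [Module.End.mul_apply, pEnd_apply, LinearMap.add_apply, LinearMap.smul_apply,
    Module.End.one_apply]
  rw [leibniz_lie, lie_p_p, if_pos hk, smul_lie, hc, smul_smul, add_comm]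

/-- On a simple module every `pₖ` acts injectively or locally nilpotently. -/
theorem pEnd_injective_or_locally_nilpotent [hV : LieModule.IsIrreducible ℂ (ExtHeis m) V]
    (k : Fin (2 * m + 2)) :
    Function.Injective (pEnd V k) ∨ ∀ v : V, ∃ n : ℕ, (pEnd V k ^ n) v = 0 := by
  have had (y : ExtHeis m) :
      y ∈ (LieModule.toEnd ℂ (ExtHeis m) (ExtHeis m) (p k)).maxGenEigenspace 0 := by
    rw [Module.End.mem_maxGenEigenspace]
    -- Bracketing with `p k` moves down the chain `h`, the `p j`, `z`, `0`, so three brackets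
    -- vanish.
    refine ⟨3, ?_⟩
    simp only [zero_smul, sub_zero, pow_succ, pow_zero, one_mul, Module.End.mul_apply,
      LieModule.toEnd_apply_apply]
    ext <;> simp
  -- Generalized eigenvalues add under the action, and both are `0` here, so `N` is stable.
  let N : LieSubmodule ℂ (ExtHeis m) V :=
    { (pEnd V k).maxGenEigenspace 0 with
      lie_mem := fun {y v} hv => by
        have := LieModule.lie_mem_maxGenEigenspace_toEnd (had y) hv
        rwa [zero_add] at this }
  have hN (v : V) : v ∈ N ↔ ∃ n : ℕ, (pEnd V k ^ n) v = 0 := by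
    change v ∈ (pEnd V k).maxGenEigenspace 0 ↔ _
    simp [Module.End.mem_maxGenEigenspace]
  rcases eq_bot_or_eq_top N with h | h
  · left
    rw [injective_iff_map_eq_zero]
    intro v hv
    have : v ∈ N := (hN v).2 ⟨1, by simpa using hv⟩
    simpa [h] using this
  · right
    intro v
    rw [← hN, h]
    exact LieSubmodule.mem_top v

/-- `pₖ` and `p_{2l-k}` are not both locally nilpotent. -/
theorem injective_pEnd_or_rev [hV : LieModule.IsIrreducible ℂ (ExtHeis m) V] {c : ℂ}
    (hc0 : c ≠ 0) (hc : HasCentralCharge m V c) (k : Fin (2 * m + 2)) :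
    Function.Injective (pEnd V k) ∨ Function.Injective (pEnd V k.rev) := by
  rcases pEnd_injective_or_locally_nilpotent (V := V) k with h | h
  · exact Or.inl h
  rcases pEnd_injective_or_locally_nilpotent (V := V) k.rev with h' | h'
  · exact Or.inr h'
  exfalso
  obtain ⟨w, hw0, hw⟩ : ∃ w : V, w ≠ 0 ∧ pEnd V k w = 0 := by
    have := LieModule.nontrivial_of_isIrreducible ℂ (ExtHeis m) V
    obtain ⟨v, hv⟩ := exists_ne (0 : V)
    obtain ⟨n, hn0, hn⟩ := Nat.exists_not_and_succ_of_not_zero_of_exists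
      (p := fun n => (pEnd V k ^ n) v = 0) (by simpa using hv) (h v)
    exact ⟨_, hn0, by rwa [← Module.End.mul_apply, ← pow_succ']⟩
  -- With `n + 1` the least power of `p_{2l-k}` killing `w`, applying `pₖ` to that zero vector
  -- leaves a nonzero multiple of the `n`-th power.
  obtain ⟨n, hn0, hn⟩ := Nat.exists_not_and_succ_of_not_zero_of_exists
    (p := fun n => (pEnd V k.rev ^ n) w = 0) (by simpa using hw0) (h' w)
  have := LinearMap.congr_fun (mul_pow_succ_of_comm_eq_smul_one (pEnd_mul_pEnd_rev hc k) n) w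
  simp only [Module.End.mul_apply, LinearMap.add_apply, LinearMap.smul_apply, hn, hw, map_zero,
    zero_add] at this
  refine smul_ne_zero (mul_ne_zero ?_ (mul_ne_zero (cocycle_ne_zero k) hc0)) hn0 this.symm
  exact_mod_cast n.succ_ne_zero

/-! ### Highest and lowest weight vectors -/

theorem exists_mem_weightSpace_ne_zero [hV : LieModule.IsIrreducible ℂ (ExtHeis m) V]
    (hw : IsWeightModule m V) : ∃ (μ : ℂ) (v : V), v ∈ weightSpace m V μ ∧ v ≠ 0 := by
  by_contra! H
  have hbot (μ : ℂ) : weightSpace m V μ = ⊥ := (Submodule.eq_bot_iff _).2 (H μ)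
  have htop : ⨆ μ, weightSpace m V μ = ⊤ := by
    let _ := Classical.decEq ℂ
    exact DirectSum.IsInternal.submodule_iSup_eq_top hw
  have := LieModule.nontrivial_of_isIrreducible ℂ (ExtHeis m) V
  simp only [hbot, iSup_bot] at htop
  exact bot_ne_top htop

/-- Pairwise commuting, locally nilpotent `pₖ` have a common weight vector in their kernels. -/
theorem exists_common_kernel [hV : LieModule.IsIrreducible ℂ (ExtHeis m) V]
    (hw : IsWeightModule m V) (S : Finset (Fin (2 * m + 2)))
    (hS : ∀ k ∈ S, ∀ j ∈ S, (k : ℕ) + j ≠ 2 * m + 1)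
    (hnil : ∀ k ∈ S, ∀ v : V, ∃ n : ℕ, (pEnd V k ^ n) v = 0) :
    ∃ (μ : ℂ) (v : V), v ∈ weightSpace m V μ ∧ v ≠ 0 ∧ ∀ k ∈ S, pEnd V k v = 0 := by
  induction S using Finset.induction_on with
  | empty =>
    obtain ⟨μ, v, hv, hv0⟩ := exists_mem_weightSpace_ne_zero hw
    exact ⟨μ, v, hv, hv0, by simp⟩
  | insert i S _ ih =>
    obtain ⟨μ, v, hv, hv0, hvS⟩ := ih
      (fun k hk j hj => hS k (Finset.mem_insert_of_mem hk) j (Finset.mem_insert_of_mem hj))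
      (fun k hk => hnil k (Finset.mem_insert_of_mem hk))
    obtain ⟨n, hn0, hn⟩ := Nat.exists_not_and_succ_of_not_zero_of_exists
      (p := fun n => (pEnd V i ^ n) v = 0) (by simpa using hv0)
      (hnil i (Finset.mem_insert_self i S) v)
    -- The last nonzero power of `pᵢ` on `v` is killed by `pᵢ`, and commutativity keeps it in the
    -- other kernels.
    refine ⟨_, _, pEnd_pow_mem_weightSpace hv i n, hn0, fun k hk => ?_⟩
    rcases Finset.mem_insert.1 hk with rfl | hkS
    · rwa [← Module.End.mul_apply, ← pow_succ']
    · have hcomm : Commute (pEnd V k) (pEnd V i ^ n) :=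
        Commute.pow_right (pEnd_mul_comm k i (hS k hk i (Finset.mem_insert_self i S))) n
      rw [← Module.End.mul_apply, hcomm.eq, Module.End.mul_apply, hvS k hkS, map_zero]

/-- The dichotomy turns non-injectivity into local nilpotency, and two indices below `l` never sum
to `2l`, so the operators commute. -/
theorem isHighestWeightModule_of_locally_nilpotent
    [hV : LieModule.IsIrreducible ℂ (ExtHeis m) V] (hw : IsWeightModule m V) {c : ℂ}
    (hc : HasCentralCharge m V c)
    (h : ∀ k : Fin (2 * m + 2), 0 < wt k → ¬ Function.Injective (pEnd V k)) :
    IsHighestWeightModule m V := by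
  obtain ⟨μ, v, hv, hv0, hk⟩ := exists_common_kernel (V := V) hw {k | 0 < wt k}
    (by intro k hk j hj; rw [Finset.mem_filter_univ, wt] at hk hj; omega)
    (fun k hk => (pEnd_injective_or_locally_nilpotent k).resolve_left (h k (by simpa using hk)))
  exact ⟨v, μ, c, hv0, Module.End.mem_eigenspace_iff.1 hv, hc v,
    fun k hk' => hk k (by simpa using hk'), LieSubmodule.lieSpan_singleton_eq_top hv0⟩

theorem isLowestWeightModule_of_locally_nilpotent
    [hV : LieModule.IsIrreducible ℂ (ExtHeis m) V] (hw : IsWeightModule m V) {c : ℂ}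
    (hc : HasCentralCharge m V c)
    (h : ∀ k : Fin (2 * m + 2), wt k < 0 → ¬ Function.Injective (pEnd V k)) :
    IsLowestWeightModule m V := by
  obtain ⟨μ, v, hv, hv0, hk⟩ := exists_common_kernel (V := V) hw {k | wt k < 0}
    (by intro k hk j hj; rw [Finset.mem_filter_univ, wt] at hk hj; omega)
    (fun k hk => (pEnd_injective_or_locally_nilpotent k).resolve_left (h k (by simpa using hk)))
  exact ⟨v, μ, c, hv0, Module.End.mem_eigenspace_iff.1 hv, hc v,
    fun k hk' => hk k (by simpa using hk'), LieSubmodule.lieSpan_singleton_eq_top hv0⟩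

/-! ### Injective operators of opposite degree -/

theorem pEnd_pow_ne_zero {k : Fin (2 * m + 2)} (hk : Function.Injective (pEnd V k)) {v : V}
    (hv : v ≠ 0) (n : ℕ) : (pEnd V k ^ n) v ≠ 0 := by
  have : Function.Injective (pEnd V k ^ n) := by
    rw [Module.End.coe_pow]
    exact hk.iterate n
  exact fun h => hv (this (by rw [h, map_zero]))

/-- If some `pₖ` with `k < l` and some `pⱼ` with `j > l` act injectively, then the support is a
full coset of `ℤ`. -/
theorem exists_mem_weightSpace_of_injective [hV : LieModule.IsIrreducible ℂ (ExtHeis m) V]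
    (hw : IsWeightModule m V) {c lam : ℂ} (hc0 : c ≠ 0) (hc : HasCentralCharge m V c)
    (hsupp : ∀ μ ∈ weightSupport m V, ∃ n : ℤ, μ = lam + n) {k j : Fin (2 * m + 2)}
    (hk : Function.Injective (pEnd V k)) (hwk : 0 < wt k)
    (hj : Function.Injective (pEnd V j)) (hwj : wt j < 0) :
    ∃ v ∈ weightSpace m V lam, v ≠ 0 := by
  obtain ⟨μ, v, hv, hv0⟩ := exists_mem_weightSpace_ne_zero hw
  obtain ⟨n, rfl⟩ := hsupp μ fun h => hv0 (by simpa [h] using hv)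
  obtain ⟨N, hN1, hN2⟩ : ∃ N : ℕ, n ≤ N ∧ -n ≤ N := ⟨n.natAbs, by omega, by omega⟩
  -- `q` and `q.rev` have degrees `1` and `-1`, and one of them acts injectively. Overshoot `lam` in
  -- the opposite direction with `N` steps of `pⱼ` or `pₖ`, then return in unit steps.
  let q : Fin (2 * m + 2) := ⟨m, by omega⟩
  have hq : wt q = 1 := by simp only [wt, q]; omega
  rcases injective_pEnd_or_rev (V := V) hc0 hc q with h | h
  · refine ⟨_, ?_, pEnd_pow_ne_zero h (pEnd_pow_ne_zero hj hv0 N)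
      (-(n + N * wt j)).toNat⟩
    convert pEnd_pow_mem_weightSpace (pEnd_pow_mem_weightSpace hv j N) q _ using 2
    rw [hq]
    have h1 : 0 ≤ -(n + N * wt j) := by
      have : (N : ℤ) * wt j ≤ N * (-1) :=
        mul_le_mul_of_nonneg_left (by omega) (by omega)
      omega
    have h2 : (((-(n + N * wt j)).toNat : ℤ) : ℂ) = ((-(n + N * wt j) : ℤ) : ℂ) := by
      rw [Int.toNat_of_nonneg h1]
    rw [Int.cast_natCast] at h2
    rw [h2]
    push_cast
    ring
  · refine ⟨_, ?_, pEnd_pow_ne_zero h (pEnd_pow_ne_zero hk hv0 N)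
      (n + N * wt k).toNat⟩
    convert pEnd_pow_mem_weightSpace (pEnd_pow_mem_weightSpace hv k N) q.rev _ using 2
    rw [wt_rev, hq]
    have h1 : 0 ≤ n + N * wt k := by
      have : (N : ℤ) * 1 ≤ N * wt k :=
        mul_le_mul_of_nonneg_left (by omega) (by omega)
      omega
    have h2 : (((n + N * wt k).toNat : ℤ) : ℂ) = ((n + N * wt k : ℤ) : ℂ) := by
      rw [Int.toNat_of_nonneg h1]
    rw [Int.cast_natCast] at h2
    rw [h2]
    push_cast
    ring

/-- If `pₖ`, `pⱼ` act injectively and have degrees of opposite sign and `j ≠ 2l - k`, then nonzero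
weight spaces are infinite-dimensional. -/
theorem not_finiteDimensional_weightSpace {c lam : ℂ} (hc0 : c ≠ 0)
    (hc : HasCentralCharge m V c) {k j : Fin (2 * m + 2)} (hkj : (k : ℕ) + j ≠ 2 * m + 1)
    (hk : Function.Injective (pEnd V k)) (hwk : 0 < wt k)
    (hj : Function.Injective (pEnd V j)) (hwj : wt j < 0)
    {v : V} (hv : v ∈ weightSpace m V lam) (hv0 : v ≠ 0) :
    ¬ FiniteDimensional ℂ (weightSpace m V lam) := by
  intro hfin
  obtain ⟨a, ha⟩ : ∃ a : ℕ, wt j = -(a + 1) := ⟨(-wt j - 1).toNat, by omega⟩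
  obtain ⟨b, hb⟩ : ∃ b : ℕ, wt k = b := ⟨(wt k).toNat, by omega⟩
  -- The exponents are `-wt j` and `wt k`, so `T` has degree zero.
  let T : Module.End ℂ V := pEnd V k ^ (a + 1) * pEnd V j ^ b
  let t : Module.End ℂ V := pEnd V k * pEnd V k.rev
  have hT : ∀ w ∈ weightSpace m V lam, T w ∈ weightSpace m V lam := fun w hw => by
    have h := pEnd_pow_mem_weightSpace (pEnd_pow_mem_weightSpace hw j b) k (a + 1)
    rw [ha, hb] at h
    push_cast at h
    rwa [show lam + b * -((a : ℂ) + 1) + (a + 1) * b = lam by ring] at h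
  have ht : ∀ w ∈ weightSpace m V lam, t w ∈ weightSpace m V lam := fun w hw => by
    have h := lie_p_mem_weightSpace (lie_p_mem_weightSpace hw k.rev) k
    rwa [wt_rev, Int.cast_neg, neg_add_cancel_right] at h
  have hrev : pEnd V k.rev * pEnd V k = pEnd V k * pEnd V k.rev + (-(cocycle k * c)) • 1 := by
    rw [pEnd_mul_pEnd_rev hc k]
    module
  have hjk : Commute (pEnd V k) (pEnd V j ^ b) := Commute.pow_right (pEnd_mul_comm k j hkj) b
  -- Both operators have negative degree.
  have hjk' : Commute (pEnd V k.rev) (pEnd V j ^ b) := by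
    refine Commute.pow_right (pEnd_mul_comm k.rev j ?_) b
    have := wt_rev k
    simp only [wt] at *
    omega
  -- `t` commutes with `pⱼ`, so only the power of `pₖ` contributes to the commutator.
  have hcomm : t * T = T * t + ((a + 1) * -(cocycle k * c)) • T := by
    calc t * T = pEnd V k * (pEnd V k.rev * pEnd V k ^ (a + 1)) * pEnd V j ^ b := by
          simp only [t, T, mul_assoc]
      _ = pEnd V k ^ (a + 1) * (pEnd V k * pEnd V k.rev * pEnd V j ^ b)
            + ((a + 1) * -(cocycle k * c)) • T := by
          rw [mul_pow_succ_of_comm_eq_smul_one hrev, mul_add, add_mul, mul_smul_comm,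
            smul_mul_assoc, ← pow_succ', ← mul_assoc (pEnd V k), ← pow_succ', pow_succ]
          simp only [T, pow_succ, mul_assoc]
      _ = T * t + ((a + 1) * -(cocycle k * c)) • T := by
          rw [(hjk.mul_left hjk').eq]
          simp only [t, T, mul_assoc]
  have : Nontrivial (weightSpace m V lam) :=
    ⟨⟨v, hv⟩, 0, fun h => hv0 (congrArg Subtype.val h)⟩
  refine not_injective_of_comm_eq_smul (W := weightSpace m V lam) (t := t.restrict ht)
    (T := T.restrict hT) (κ := (a + 1) * -(cocycle k * c)) ?_ ?_ ?_
  · refine mul_ne_zero ?_ (neg_ne_zero.2 (mul_ne_zero (cocycle_ne_zero k) hc0))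
    exact_mod_cast a.succ_ne_zero
  · exact LinearMap.ext fun w => Subtype.ext (LinearMap.congr_fun hcomm w)
  · rw [injective_iff_map_eq_zero]
    intro w hw
    by_contra hw0
    refine pEnd_pow_ne_zero hk (pEnd_pow_ne_zero hj (v := (w : V)) ?_ b) (a + 1)
      (congrArg Subtype.val hw)
    exact fun h => hw0 (Subtype.ext h)

end ExtHeis

/-! ### Homomorphisms from `D(a, c)` -/

namespace DModule

variable {V : Type u} [AddCommGroup V] [Module ℂ V] [LieRingModule (ExtHeis 0) V]
  [LieModule ℂ (ExtHeis 0) V] {a c b : ℂ}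

variable (a c b) in
/-- The basis of `D(a, c)` formed by the `xⁱ`. -/
def basis : Module.Basis ℤ ℂ (DModule a c b) := AddMonoidAlgebra.basis ℤ ℂ

theorem basis_apply (i : ℤ) : basis a c b i = x a c b i := rfl

theorem _root_.ExtHeis.eq_sum_of_zero (y : ExtHeis 0) :
    y = y.1 • ExtHeis.h + y.2.1 0 • ExtHeis.p 0 + y.2.1 1 • ExtHeis.p 1 + y.2.2 • ExtHeis.z := by
  ext k
  · simp
  · fin_cases k <;> simp
  · simp

/-- The homomorphism `xⁱ ↦ f i` from `D(a, c)`. -/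
def lift (f : ℤ → V) (hh : ∀ i, ⁅(ExtHeis.h : ExtHeis 0), f i⁆ = (b - i) • f i)
    (h0 : ∀ i, ⁅(ExtHeis.p 0 : ExtHeis 0), f i⁆ = (-c * (a + i)) • f (i - 1))
    (h1 : ∀ i, ⁅(ExtHeis.p 1 : ExtHeis 0), f i⁆ = f (i + 1))
    (hz : ∀ i, ⁅(ExtHeis.z : ExtHeis 0), f i⁆ = c • f i) :
    DModule a c b →ₗ⁅ℂ, ExtHeis 0⁆ V :=
  { (basis a c b).constr ℂ f with
    map_lie' := fun {y w} => by
      have key : (basis a c b).constr ℂ f ∘ₗ LieModule.toEnd ℂ (ExtHeis 0) (DModule a c b) y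
          = LieModule.toEnd ℂ (ExtHeis 0) V y ∘ₗ (basis a c b).constr ℂ f := by
        refine (basis a c b).ext fun i => ?_
        have hx (j : ℤ) : (basis a c b).constr ℂ f (x a c b j) = f j :=
          (basis a c b).constr_basis ℂ f j
        rw [LinearMap.comp_apply, LinearMap.comp_apply, LieModule.toEnd_apply_apply,
          LieModule.toEnd_apply_apply, basis_apply, hx, ExtHeis.eq_sum_of_zero y]
        simp only [add_lie, smul_lie, lie_h_x, lie_p_zero_x, lie_p_one_x, lie_z_x, map_add,
          map_smul, hx, hh, h0, h1, hz]
      exact LinearMap.congr_fun key w }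

theorem lift_x (f : ℤ → V) (hh h0 h1 hz) (i : ℤ) :
    lift (a := a) (c := c) (b := b) f hh h0 h1 hz (x a c b i) = f i :=
  (basis a c b).constr_basis ℂ f i

/-- The `f i` have distinct `h`-weights, so the induced map is injective; its image is a nonzero
submodule of the simple module `V`. -/
theorem nonempty_equiv [LieModule.IsIrreducible ℂ (ExtHeis 0) V] (f : ℤ → V)
    (hf : ∀ i, f i ≠ 0)
    (hh : ∀ i, ⁅(ExtHeis.h : ExtHeis 0), f i⁆ = (b - i) • f i)
    (h0 : ∀ i, ⁅(ExtHeis.p 0 : ExtHeis 0), f i⁆ = (-c * (a + i)) • f (i - 1))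
    (h1 : ∀ i, ⁅(ExtHeis.p 1 : ExtHeis 0), f i⁆ = f (i + 1))
    (hz : ∀ i, ⁅(ExtHeis.z : ExtHeis 0), f i⁆ = c • f i) :
    Nonempty (V ≃ₗ⁅ℂ, ExtHeis 0⁆ DModule a c b) := by
  let φ := lift f hh h0 h1 hz
  have hli : LinearIndependent ℂ f := by
    refine Module.End.eigenvectors_linearIndependent'
      (LieModule.toEnd ℂ (ExtHeis 0) V ExtHeis.h) (fun i : ℤ => b - i) ?_ f fun i =>
        ⟨Module.End.mem_eigenspace_iff.2 (hh i), hf i⟩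
    exact fun i j hij => by simpa using hij
  have hinj : Function.Injective φ :=
    (basis a c b).injective_constr_of_linearIndependent hli
  have hsurj : Function.Surjective φ := by
    rw [← LieModuleHom.range_eq_top]
    refine (eq_bot_or_eq_top _).resolve_left fun h => hf 0 ?_
    have : f 0 ∈ φ.range := (LieModuleHom.mem_range _ _).2 ⟨_, lift_x f hh h0 h1 hz 0⟩
    simpa [h] using this
  exact ⟨LieModuleEquiv.symm
    { φ with
      invFun := (Equiv.ofBijective φ ⟨hinj, hsurj⟩).symm
      left_inv := (Equiv.ofBijective φ ⟨hinj, hsurj⟩).left_inv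
      right_inv := (Equiv.ofBijective φ ⟨hinj, hsurj⟩).right_inv }⟩

end DModule

/-! ### The case where `p₀` and `p₁` both act injectively, `l = 1/2` -/

namespace ExtHeis

variable {V : Type u} [AddCommGroup V] [Module ℂ V] [LieRingModule (ExtHeis 0) V]
  [LieModule ℂ (ExtHeis 0) V]

theorem nonempty_equiv_dModule [hV : LieModule.IsIrreducible ℂ (ExtHeis 0) V] {c lam : ℂ}
    (hc0 : c ≠ 0) (hc : HasCentralCharge 0 V c)
    (hp0 : Function.Injective (pEnd V (0 : Fin (2 * 0 + 2))))
    (hp1 : Function.Injective (pEnd V (1 : Fin (2 * 0 + 2))))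
    (hne : ∃ v ∈ weightSpace 0 V lam, v ≠ 0) [FiniteDimensional ℂ (weightSpace 0 V lam)] :
    ∃ a b : ℂ, (∀ n : ℤ, a ≠ n) ∧ Nonempty (V ≃ₗ⁅ℂ, ExtHeis 0⁆ DModule a c b) := by
  set P0 := pEnd V (0 : Fin (2 * 0 + 2))
  set P1 := pEnd V (1 : Fin (2 * 0 + 2))
  have hwt0 : wt (0 : Fin (2 * 0 + 2)) = 1 := by simp [wt]
  have hwt1 : wt (1 : Fin (2 * 0 + 2)) = -1 := by simp [wt]
  have h01 : P0 * P1 = P1 * P0 + (-c) • 1 := by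
    have h := pEnd_mul_pEnd_rev hc (0 : Fin (2 * 0 + 2))
    have h2 : cocycle (0 : Fin (2 * 0 + 2)) * c = -c := by simp [cocycle]
    rwa [h2] at h
  have h10 : P1 * P0 = P0 * P1 + c • 1 := by rw [h01]; module
  -- an eigenvector of `p₁ p₀` in the finite-dimensional weight space
  obtain ⟨v, τ, hv, hv0, hτ⟩ : ∃ (v : V) (τ : ℂ), v ∈ weightSpace 0 V lam ∧ v ≠ 0 ∧
      P1 (P0 v) = τ • v := by
    obtain ⟨w, hw, hw0⟩ := hne
    have : Nontrivial (weightSpace 0 V lam) :=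
      ⟨⟨w, hw⟩, 0, fun h => hw0 (congrArg Subtype.val h)⟩
    have ht : ∀ w ∈ weightSpace 0 V lam, (P1 * P0) w ∈ weightSpace 0 V lam := fun w hw => by
      have h := lie_p_mem_weightSpace (lie_p_mem_weightSpace hw 0) 1
      rwa [hwt0, hwt1, Int.cast_neg, add_neg_cancel_right] at h
    obtain ⟨τ, hτ⟩ := Module.End.exists_eigenvalue ((P1 * P0).restrict ht)
    obtain ⟨v, hv, hv0⟩ := hτ.exists_hasEigenvector
    exact ⟨v, τ, v.2, fun h => hv0 (Subtype.ext h),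
      congrArg Subtype.val (Module.End.mem_eigenspace_iff.1 hv)⟩
  -- In `D(a, c)`, `p₁ p₀` acts on `x⁰` by `-c a`; this reads off `a`.
  obtain ⟨a, rfl⟩ : ∃ a, τ = -c * a := ⟨-τ / c, by field_simp⟩
  have hτ' : P0 (P1 v) = (-c * (a + 1)) • v := by
    have := LinearMap.congr_fun h01 v
    simp only [Module.End.mul_apply, LinearMap.add_apply, LinearMap.smul_apply,
      Module.End.one_apply, hτ] at this
    rw [this]
    module
  have hpos (n : ℕ) : P0 ((P1 ^ (n + 1)) v) = (-c * (a + (n + 1))) • (P1 ^ n) v := by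
    have := LinearMap.congr_fun (mul_pow_succ_of_comm_eq_smul_one h01 n) v
    rw [pow_succ P1 n, mul_assoc (P1 ^ n)] at this
    simp only [Module.End.mul_apply, LinearMap.add_apply, LinearMap.smul_apply, hτ,
      map_smul] at this
    rw [pow_succ, Module.End.mul_apply, this]
    module
  have hneg (n : ℕ) : P1 ((P0 ^ (n + 1)) v) = (-c * (a - n)) • (P0 ^ n) v := by
    have := LinearMap.congr_fun (mul_pow_succ_of_comm_eq_smul_one h10 n) v
    rw [pow_succ P0 n, mul_assoc (P0 ^ n)] at this
    simp only [Module.End.mul_apply, LinearMap.add_apply, LinearMap.smul_apply, hτ',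
      map_smul] at this
    rw [pow_succ, Module.End.mul_apply, this]
    module
  have hcoef (n : ℕ) : -c * (a - n) ≠ 0 := fun h => by
    refine pEnd_pow_ne_zero hp0 hv0 (n + 1) (hp1 ?_)
    rw [hneg, h, zero_smul, map_zero]
  -- For `a = n ≥ 0`, `p₁` would kill `p₀ⁿ⁺¹ v`; for `a = -(n + 1)`, `p₀` would kill `p₁ⁿ⁺¹ v`.
  have ha (n : ℤ) : a ≠ n := by
    rintro rfl
    obtain ⟨n, rfl | rfl⟩ := n.eq_nat_or_neg
    · exact hcoef n (by simp)
    · rcases n with _ | n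
      · exact hcoef 0 (by simp)
      · refine pEnd_pow_ne_zero hp1 hv0 (n + 1) (hp0 ?_)
        rw [hpos, map_zero]
        simp
  refine ⟨a, lam, ha, ?_⟩
  -- Normalizes the `p₀`-side of the string so that `p₁` sends each vector to the next with
  -- coefficient one.
  let r (n : ℕ) : ℂ := ∏ j ∈ Finset.range n, (-c * (a - j))
  have hr (n : ℕ) : r n ≠ 0 := Finset.prod_ne_zero_iff.2 fun j _ => hcoef j
  have hr_succ (n : ℕ) : (-c * (a - n)) * (r (n + 1))⁻¹ = (r n)⁻¹ := by
    have h := hr n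
    have h' := hcoef n
    simp only [r, Finset.prod_range_succ] at h ⊢
    rw [mul_inv, mul_left_comm, mul_inv_cancel₀ h', mul_one]
  let f : ℤ → V := fun i => match i with
    | Int.ofNat n => (P1 ^ n) v
    | Int.negSucc n => (r (n + 1))⁻¹ • (P0 ^ (n + 1)) v
  have f_nat (n : ℕ) : f n = (P1 ^ n) v := rfl
  have f_neg (n : ℕ) : f (-n) = (r n)⁻¹ • (P0 ^ n) v := by
    rcases n with _ | n
    · simp [f, r]
    · rfl
  have f_wt (i : ℤ) : f i ∈ weightSpace 0 V (lam - i) := by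
    obtain ⟨n, rfl | rfl⟩ := i.eq_nat_or_neg
    · have h := pEnd_pow_mem_weightSpace hv 1 n
      rw [hwt1, Int.cast_neg, Int.cast_one, mul_neg_one, ← sub_eq_add_neg] at h
      rw [f_nat, Int.cast_natCast]
      exact h
    · have h := pEnd_pow_mem_weightSpace hv 0 n
      rw [hwt0, Int.cast_one, mul_one] at h
      rw [f_neg, Int.cast_neg, Int.cast_natCast, sub_neg_eq_add]
      exact Submodule.smul_mem _ _ h
  refine DModule.nonempty_equiv f ?_ (fun i => Module.End.mem_eigenspace_iff.1 (f_wt i)) ?_ ?_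
    (fun i => hc (f i))
  · intro i
    obtain ⟨n, rfl | rfl⟩ := i.eq_nat_or_neg
    · exact pEnd_pow_ne_zero hp1 hv0 n
    · rw [f_neg]
      exact smul_ne_zero (inv_ne_zero (hr n)) (pEnd_pow_ne_zero hp0 hv0 n)
  · intro i
    change P0 (f i) = _
    -- Index `0` belongs with the negative half, since `p₀` lowers the index.
    obtain ⟨n, rfl | rfl⟩ : ∃ n : ℕ, i = (n + 1 : ℕ) ∨ i = -n := by
      rcases i with n | n
      · rcases n with _ | n
        · exact ⟨0, Or.inr rfl⟩
        · exact ⟨n, Or.inl rfl⟩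
      · exact ⟨n + 1, Or.inr rfl⟩
    · rw [f_nat, hpos, show ((n + 1 : ℕ) : ℤ) - 1 = n by simp, f_nat]
      simp
    · rw [f_neg, show (-(n : ℤ)) - 1 = -((n + 1 : ℕ) : ℤ) by push_cast; ring, f_neg, map_smul,
        smul_smul, Int.cast_neg, Int.cast_natCast, ← sub_eq_add_neg, hr_succ, pow_succ',
        Module.End.mul_apply]
  · intro i
    change P1 (f i) = _
    rcases i with n | n
    · change P1 ((P1 ^ n) v) = (P1 ^ (n + 1)) v
      rw [pow_succ', Module.End.mul_apply]
    · rw [show Int.negSucc n = -((n + 1 : ℕ) : ℤ) from rfl, f_neg, map_smul, hneg, smul_smul,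
        mul_comm, hr_succ, show -((n + 1 : ℕ) : ℤ) + 1 = -n by push_cast; ring, f_neg]

end ExtHeis

end

/-! ### The classification -/

theorem mainTheorem7 :
    -- the case `l = 1/2`
    (∀ (V : Type u) [AddCommGroup V] [Module ℂ V] [LieRingModule (ExtHeis 0) V]
        [LieModule ℂ (ExtHeis 0) V] (c lam : ℂ),
      LieModule.IsIrreducible ℂ (ExtHeis 0) V →
      IsWeightModule 0 V →
      c ≠ 0 → HasCentralCharge 0 V c →
      (∀ μ ∈ weightSupport 0 V, ∃ n : ℤ, μ = lam + n) →
      FiniteDimensional ℂ (weightSpace 0 V lam) →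
      IsHighestWeightModule 0 V ∨ IsLowestWeightModule 0 V ∨
        ∃ a b : ℂ, (∀ n : ℤ, a ≠ n) ∧ Nonempty (V ≃ₗ⁅ℂ, ExtHeis 0⁆ DModule a c b)) ∧
    -- the case `l = m + 1/2` with `m ≥ 1`
    (∀ (m : ℕ), 1 ≤ m →
      ∀ (V : Type u) [AddCommGroup V] [Module ℂ V] [LieRingModule (ExtHeis m) V]
        [LieModule ℂ (ExtHeis m) V] (c lam : ℂ),
      LieModule.IsIrreducible ℂ (ExtHeis m) V →
      IsWeightModule m V →
      c ≠ 0 → HasCentralCharge m V c →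
      (∀ μ ∈ weightSupport m V, ∃ n : ℤ, μ = lam + n) →
      FiniteDimensional ℂ (weightSpace m V lam) →
      IsHighestWeightModule m V ∨ IsLowestWeightModule m V) := by
  refine ⟨?_, ?_⟩
  · intro V _ _ _ _ c lam hV hw hc0 hc hsupp hfin
    by_cases hhi : ∀ k : Fin (2 * 0 + 2), 0 < @ExtHeis.wt 0 k → ¬ Function.Injective (ExtHeis.pEnd V k)
    · exact Or.inl (ExtHeis.isHighestWeightModule_of_locally_nilpotent hw hc hhi)
    by_cases hlo : ∀ k : Fin (2 * 0 + 2), @ExtHeis.wt 0 k < 0 → ¬ Function.Injective (ExtHeis.pEnd V k)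
    · exact Or.inr (Or.inl (ExtHeis.isLowestWeightModule_of_locally_nilpotent hw hc hlo))
    push Not at hhi hlo
    obtain ⟨k, hwk, hk⟩ := hhi
    obtain ⟨j, hwj, hj⟩ := hlo
    have hne := ExtHeis.exists_mem_weightSpace_of_injective hw hc0 hc hsupp hk hwk hj hwj
    obtain rfl : k = 0 := Fin.ext (by rw [ExtHeis.wt] at hwk; change (k : ℕ) = 0; omega)
    obtain rfl : j = 1 := Fin.ext (by rw [ExtHeis.wt] at hwj; change (j : ℕ) = 1; omega)
    exact Or.inr (Or.inr (ExtHeis.nonempty_equiv_dModule hc0 hc hk hj hne))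
  · intro m hm V _ _ _ _ c lam hV hw hc0 hc hsupp hfin
    by_cases hhi : ∀ k : Fin (2 * m + 2), 0 < ExtHeis.wt k → ¬ Function.Injective (ExtHeis.pEnd V k)
    · exact Or.inl (ExtHeis.isHighestWeightModule_of_locally_nilpotent hw hc hhi)
    by_cases hlo : ∀ k : Fin (2 * m + 2), ExtHeis.wt k < 0 → ¬ Function.Injective (ExtHeis.pEnd V k)
    · exact Or.inr (ExtHeis.isLowestWeightModule_of_locally_nilpotent hw hc hlo)
    exfalso
    push Not at hhi hlo
    obtain ⟨k, hwk, hk⟩ := hhi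
    obtain ⟨j, hwj, hj⟩ := hlo
    obtain ⟨v, hv, hv0⟩ := ExtHeis.exists_mem_weightSpace_of_injective hw hc0 hc hsupp hk hwk hj hwj
    by_cases hkj : (k : ℕ) + j = 2 * m + 1
    -- As `m ≥ 1`, both `p₀` and `p₁` have positive degree. Whichever of `pᵢ`, `p_{2l-i}` is
    -- injective forms a commuting pair with `pⱼ` or `pₖ` respectively.
    · obtain ⟨i, hi, hik⟩ : ∃ i : Fin (2 * m + 2), 0 < ExtHeis.wt i ∧ i ≠ k := by
        by_cases hk0 : (k : ℕ) = 0
        · exact ⟨⟨1, by omega⟩, by simp only [ExtHeis.wt]; omega, fun h => by simp [← h] at hk0⟩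
        · exact ⟨⟨0, by omega⟩, by simp only [ExtHeis.wt]; omega, fun h => by simp [← h] at hk0⟩
      rw [ne_eq, Fin.ext_iff] at hik
      rcases ExtHeis.injective_pEnd_or_rev (V := V) hc0 hc i with h | h
      · exact ExtHeis.not_finiteDimensional_weightSpace hc0 hc (by omega) h hi hj hwj hv hv0 hfin
      · refine ExtHeis.not_finiteDimensional_weightSpace hc0 hc ?_ hk hwk h ?_ hv hv0 hfin
        · rw [Fin.val_rev]
          omega
        · rw [ExtHeis.wt_rev]
          omega
    · exact ExtHeis.not_finiteDimensional_weightSpace hc0 hc hkj hk hwk hj hwj hv hv0 hfin
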